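/- Let $\zeta\in\mathbb{C}$ be either square root of $\frac{-1+i\sqrt7}{2}$, and let $$\alpha=\tfrac12\zeta^3+\zeta,\qquad d(\lambda)=\operatorname{Im}\bigl(\bar\alpha\,J_0(\lambda\zeta)\,J_1(\lambda\bar\zeta)\bigr),$$ where $J_n(z)=\sum_{k\ge0}\frac{(-1)^k}{k!\,(k+n)!}(z/2)^{2k+n}$ are the Bessel functions of the first kind. Fix $\lambda>0$ with $d(\lambda)J_1(\lambda)\neq0$. Consider the system $$\begin{aligned} r^2A''(r)+rA'(r)-A(r)+\lambda^2r^2A(r)+2\lambda r^2C'(r)&=0,\\ r^2B''(r)+rB'(r)-B(r)+\lambda^2r^2B(r)&=0,\\ C'(r)+rC''(r)+2\lambda^2rC(r)+2\lambda rA'(r)+2\lambda A(r)&=0 \end{aligned}$$ for real-valued functions, with the boundary conditions $$A(0)=B(0)=C'(0)=0,\qquad A(1)=B(1)=0,\qquad C(1)=1.$$ Then the real-valued functions $$A_\lambda(r)=\frac{\sqrt2}{d(\lambda)}\operatorname{Im}\bigl(J_1(\lambda\bar\zeta)J_1(\lambda\zeta r)\bigr),\qquad B_\lambda(r)=0,\qquad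 C_\lambda(r)=\frac1{d(\lambda)}\operatorname{Im}\bigl(\bar\alpha J_1(\lambda\bar\zeta)J_0(\lambda\zeta r)\bigr)$$ are infinitely differentiable, are the same for both choices of $\zeta$, and form the unique solution of this boundary value problem. More precisely, for every interval $I$ with $[0,1]\subseteq I\subseteq[0,\infty)$, $(A_\lambda,B_\lambda,C_\lambda)$ is a solution on $I$, and any solution $(A,B,C)$ on $I$ coincides with it on $I$. Here a solution on $I$ consists of functions that are continuous on $I$ and twice differentiable in the interior of $I$, satisfy the system there and satisfy the boundary conditions ($C'(0)$ being the one-sided derivative). -/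

import Mathlib

noncomputable section

namespace RadialSystem

open scoped Nat

/-- The Bessel function of the first kind `J_n` of integer order `n ≥ 0`, by its power series
(which converges at every complex number). -/
def besselJ (n : ℕ) (z : ℂ) : ℂ :=
  ∑' k : ℕ, (-1 : ℂ) ^ k / ((k ! : ℂ) * ((k + n)! : ℂ)) * (z / 2) ^ (2 * k + n)

theorem summable_besselJ (n : ℕ) (z : ℂ) :
    Summable fun k : ℕ =>
      (-1 : ℂ) ^ k / ((k ! : ℂ) * ((k + n)! : ℂ)) * (z / 2) ^ (2 * k + n) := by
  have h := (Real.summable_pow_div_factorial (‖z / 2‖ ^ 2)).mul_left (‖z / 2‖ ^ n)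
  refine Summable.of_norm_bounded h fun k => ?_
  rw [norm_mul, norm_div, norm_pow, norm_neg, norm_one, one_pow, norm_mul, norm_pow,
    Complex.norm_natCast, Complex.norm_natCast, pow_add, pow_mul]
  have h1 : (1 : ℝ) ≤ ((k + n)! : ℝ) := by exact_mod_cast Nat.factorial_pos _
  have h0 : (0 : ℝ) < (k ! : ℝ) := by exact_mod_cast Nat.factorial_pos _
  have h2 : 1 / ((k ! : ℝ) * ((k + n)! : ℝ)) ≤ 1 / (k ! : ℝ) :=
    one_div_le_one_div_of_le h0 (le_mul_of_one_le_right h0.le h1)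
  calc 1 / ((k ! : ℝ) * ((k + n)! : ℝ)) * ((‖z / 2‖ ^ 2) ^ k * ‖z / 2‖ ^ n)
      ≤ 1 / (k ! : ℝ) * ((‖z / 2‖ ^ 2) ^ k * ‖z / 2‖ ^ n) := by gcongr
    _ = ‖z / 2‖ ^ n * ((‖z / 2‖ ^ 2) ^ k / (k ! : ℝ)) := by ring

/-- `α = ζ³ / 2 + ζ`. -/
def alpha (ζ : ℂ) : ℂ := ζ ^ 3 / 2 + ζ

/-- `d(λ) = Im (ᾱ J₀(λ ζ) J₁(λ ζ̄))`. -/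
def d (ζ : ℂ) (lam : ℝ) : ℝ :=
  (starRingEnd ℂ (alpha ζ) * besselJ 0 (lam * ζ) * besselJ 1 (lam * starRingEnd ℂ ζ)).im

/-- `A_λ(r) = (√2 / d(λ)) Im (J₁(λ ζ̄) J₁(λ ζ r))`. -/
def solA (ζ : ℂ) (lam : ℝ) (r : ℝ) : ℝ :=
  √2 / d ζ lam * (besselJ 1 (lam * starRingEnd ℂ ζ) * besselJ 1 (lam * ζ * r)).im

/-- `C_λ(r) = (1 / d(λ)) Im (ᾱ J₁(λ ζ̄) J₀(λ ζ r))`. -/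
def solC (ζ : ℂ) (lam : ℝ) (r : ℝ) : ℝ :=
  1 / d ζ lam *
    (starRingEnd ℂ (alpha ζ) * besselJ 1 (lam * starRingEnd ℂ ζ) * besselJ 0 (lam * ζ * r)).im

/-- Existence of the second derivative of `f` at `r`, so that `deriv f r` and
`deriv (deriv f) r` are the actual derivatives. -/
def TwiceDifferentiableAt (f : ℝ → ℝ) (r : ℝ) : Prop :=
  (∀ᶠ s in nhds r, DifferentiableAt ℝ f s) ∧ DifferentiableAt ℝ (deriv f) r

/-- `A, B, C` solve the radial boundary value problem with parameter `lam` on the interval `I`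
(used for intervals with `[0, 1] ⊆ I ⊆ [0, ∞)`): they are continuous on `I`, twice differentiable
in its interior, satisfy the differential system there and take the boundary values. -/
structure IsSolution (lam : ℝ) (I : Set ℝ) (A B C : ℝ → ℝ) : Prop where
  continuousOn_A : ContinuousOn A I
  continuousOn_B : ContinuousOn B I
  continuousOn_C : ContinuousOn C I
  twiceDiff_A : ∀ r ∈ interior I, TwiceDifferentiableAt A r
  twiceDiff_B : ∀ r ∈ interior I, TwiceDifferentiableAt B r
  twiceDiff_C : ∀ r ∈ interior I, TwiceDifferentiableAt C r
  eq_A : ∀ r ∈ interior I,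
    r ^ 2 * deriv (deriv A) r + r * deriv A r - A r + lam ^ 2 * r ^ 2 * A r
      + 2 * lam * r ^ 2 * deriv C r = 0
  eq_B : ∀ r ∈ interior I,
    r ^ 2 * deriv (deriv B) r + r * deriv B r - B r + lam ^ 2 * r ^ 2 * B r = 0
  eq_C : ∀ r ∈ interior I,
    deriv C r + r * deriv (deriv C) r + 2 * lam ^ 2 * r * C r
      + 2 * lam * r * deriv A r + 2 * lam * A r = 0
  A_zero : A 0 = 0
  B_zero : B 0 = 0
  deriv_C_zero : HasDerivWithinAt C 0 I 0
  A_one : A 1 = 0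
  B_one : B 1 = 0
  C_one : C 1 = 1

end RadialSystem

end

namespace RadialSystem

open Filter Topology Set

/-! Existence is a computation. The system has real coefficients, so imaginary parts of complex
solutions solve it. With μ = λζ, insert A = √2 J₁(μr), C = ᾱ J₀(μr). By J₀' = -J₁ and (z J₁)' = z J₀
the equations become √2(1 - ζ²) = 2ζᾱ and (2 - ζ²)ᾱ + 2ζ√2 = 0, which are compatible because ζ⁴ + ζ²
+ 2 = 0. A complex multiple c of this solution is again one (`isPairSolution_bessel`); c =
J₁(λζ̄)/d(λ) gives the boundary values at 1.

For uniqueness, take the difference (A, C) of two solutions; it vanishes at 1. If I = [0, 1],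
derivatives at 1 are not available, so Cauchy uniqueness cannot start there. Instead, pair (A, C)
with a solution (u, v) that is smooth up to 0. Lagrange's identity makes r times an alternating form
in the values and first derivatives constant. That constant is a limit at 0 of r F'(r) with F = uA -
vC continuous at 0, hence is zero (`IsPairSolution.lagrange_eq_zero`). Two such (u, v), from c = 1
and c = i, give two linear equations for A' and C' in terms of A and C. Their determinant at 1 is
-√2 d(λ) ≠ 0, so near 1 there is a first-order linear system with bounded coefficients, and Grönwall
yields A = C = 0 there. An energy estimate, valid away from r = 0, carries this through the interior
of I, and continuity gives the endpoints.

The equation for B is decoupled. It is handled by the same theorem, as the pair (B, 0) in a system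
with q = κ = 0; the determinant there is J₁(λ). -/

/-! ### Power series and recurrences of J₀ and J₁. -/

open scoped Nat in
theorem differentiable_besselJ (n : ℕ) : Differentiable ℂ (besselJ n) ∧ ∀ z : ℂ,
    HasSum (fun k : ℕ => (-1 : ℂ) ^ k / ((k ! : ℂ) * ((k + n)! : ℂ)) *
      (((2 * k + n : ℕ) : ℂ) * (z / 2) ^ (2 * k + n - 1) * (1 / 2))) (deriv (besselJ n) z) := by
  set F : ℕ → ℂ → ℂ := fun k z =>
    (-1 : ℂ) ^ k / ((k ! : ℂ) * ((k + n)! : ℂ)) * (z / 2) ^ (2 * k + n) with hF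
  have hder : ∀ k z, HasDerivAt (F k) ((-1 : ℂ) ^ k / ((k ! : ℂ) * ((k + n)! : ℂ)) *
      (((2 * k + n : ℕ) : ℂ) * (z / 2) ^ (2 * k + n - 1) * (1 / 2))) z := fun k z =>
    ((((hasDerivAt_id z).div_const 2).pow (2 * k + n)).const_mul _)
  have hbound : ∀ R : ℝ, ∃ u : ℕ → ℝ, Summable u ∧
      ∀ k, ∀ w ∈ Metric.ball (0 : ℂ) R, ‖F k w‖ ≤ u k := by
    intro R
    -- Each term is a monomial, so its modulus on the ball is at most its modulus at the point R.
    refine ⟨fun k => ‖F k (R : ℂ)‖, (summable_besselJ n R).norm, fun k w hw => ?_⟩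
    have hw' : ‖w‖ ≤ ‖(R : ℂ)‖ := by
      rw [Complex.norm_real]
      exact (mem_ball_zero_iff.1 hw).le.trans (le_abs_self R)
    simp only [hF, norm_mul, norm_pow, norm_div]
    gcongr
  have key : ∀ z : ℂ, z ∈ Metric.ball (0 : ℂ) (‖z‖ + 1) := fun z => by simp
  constructor
  · intro z
    obtain ⟨u, hu, hb⟩ := hbound (‖z‖ + 1)
    exact (Complex.differentiableOn_tsum_of_summable_norm hu
      (fun k w _ => (hder k w).differentiableAt.differentiableWithinAt) Metric.isOpen_ball
      hb).differentiableAt (Metric.isOpen_ball.mem_nhds (key z))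
  · intro z
    obtain ⟨u, hu, hb⟩ := hbound (‖z‖ + 1)
    have h := Complex.hasSum_deriv_of_summable_norm hu
      (fun k w _ => (hder k w).differentiableAt.differentiableWithinAt) Metric.isOpen_ball
      hb (key z)
    simp only [(hder _ _).deriv] at h
    exact h

open scoped Nat in
theorem deriv_besselJ_zero (z : ℂ) : deriv (besselJ 0) z = -besselJ 1 z := by
  have h := (differentiable_besselJ 0).2 z
  -- The term k = 0 is constant, so its derivative drops out; the shift k + 1 gives the series of
  -- -J₁.
  rw [← hasSum_nat_add_iff' 1] at h
  simp only [Finset.range_one, Finset.sum_singleton, mul_zero, add_zero, Nat.cast_zero, zero_mul,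
    sub_zero] at h
  refine h.unique ?_
  have h1 := (summable_besselJ 1 z).hasSum.neg
  refine h1.congr_fun fun k => ?_
  have e : 2 * (k + 1) - 1 = 2 * k + 1 := by omega
  have hk : ((k ! : ℕ) : ℂ) ≠ 0 := by exact_mod_cast Nat.factorial_ne_zero k
  have hk1 : (k : ℂ) + 1 ≠ 0 := by exact_mod_cast Nat.succ_ne_zero k
  rw [e, Nat.factorial_succ]
  push_cast
  field_simp
  ring

open scoped Nat in
theorem mul_deriv_besselJ_one (z : ℂ) :
    z * deriv (besselJ 1) z + besselJ 1 z = z * besselJ 0 z := by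
  have h := (((differentiable_besselJ 1).2 z).mul_left z).add (summable_besselJ 1 z).hasSum
  refine h.unique ?_
  refine ((summable_besselJ 0 z).hasSum.mul_left z).congr_fun fun k => ?_
  have hk : ((k ! : ℕ) : ℂ) ≠ 0 := by exact_mod_cast Nat.factorial_ne_zero k
  have hk1 : (k : ℂ) + 1 ≠ 0 := by exact_mod_cast Nat.succ_ne_zero k
  rw [Nat.add_sub_cancel, Nat.add_zero, Nat.add_zero, Nat.factorial_succ]
  push_cast
  generalize (k ! : ℂ) = c at hk ⊢
  have e : c * ((k + 1) * c) ≠ 0 := mul_ne_zero hk (mul_ne_zero hk1 hk)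
  rw [pow_succ (z / 2)]
  field_simp
  ring

theorem besselJ_one_zero : besselJ 1 0 = 0 := by
  simpa using mul_deriv_besselJ_one 0

theorem besselJ_neg (n : ℕ) (z : ℂ) : besselJ n (-z) = (-1) ^ n * besselJ n z := by
  unfold besselJ
  rw [← tsum_mul_left]
  refine tsum_congr fun k => ?_
  rw [neg_div, neg_pow (z / 2), pow_add, pow_mul]
  norm_num
  ring

theorem conj_besselJ (n : ℕ) (z : ℂ) :
    starRingEnd ℂ (besselJ n z) = besselJ n (starRingEnd ℂ z) := by
  unfold besselJ
  rw [Complex.conj_tsum]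
  refine tsum_congr fun k => ?_
  simp [Complex.conj_ofNat]

theorem mul_deriv_deriv_besselJ_one (z : ℂ) :
    z * deriv (deriv (besselJ 1)) z + 2 * deriv (besselJ 1) z = besselJ 0 z - z * besselJ 1 z := by
  have d0 := (differentiable_besselJ 0).1
  have d1 := (differentiable_besselJ 1).1
  have d2 : Differentiable ℂ (deriv (besselJ 1)) := d1.deriv
  have hl := ((hasDerivAt_id z).mul (d2 z).hasDerivAt).add (d1 z).hasDerivAt
  have hr := (hasDerivAt_id z).mul (d0 z).hasDerivAt
  have e : (id * deriv (besselJ 1) + besselJ 1 : ℂ → ℂ) = id * besselJ 0 :=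
    funext mul_deriv_besselJ_one
  rw [e] at hl
  have := hl.unique hr
  rw [deriv_besselJ_zero] at this
  simp only [id] at this
  linear_combination this

/-! ### Imaginary parts of scaled entire functions. -/

/-- The real function `r ↦ Im (a g(μ r))`. -/
noncomputable def imScale (g : ℂ → ℂ) (a μ : ℂ) (r : ℝ) : ℝ := (a * g (μ * r)).im

theorem hasDerivAt_imScale {g : ℂ → ℂ} (hg : Differentiable ℂ g) (a μ : ℂ) (r : ℝ) :
    HasDerivAt (imScale g a μ) (imScale (deriv g) (a * μ) μ r) r := by
  have h1 : HasDerivAt (fun z : ℂ => a * g (μ * z)) (a * μ * deriv g (μ * r)) (r : ℂ) := by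
    have h := (((hg (μ * r)).hasDerivAt.comp (r : ℂ)
      ((hasDerivAt_id (r : ℂ)).const_mul μ)).const_mul a)
    exact h.congr_deriv (by rw [mul_one, mul_comm (deriv g _), mul_assoc])
  exact Complex.imCLM.hasFDerivAt.comp_hasDerivAt r h1.comp_ofReal

theorem deriv_imScale {g : ℂ → ℂ} (hg : Differentiable ℂ g) (a μ : ℂ) :
    deriv (imScale g a μ) = imScale (deriv g) (a * μ) μ :=
  funext fun r => (hasDerivAt_imScale hg a μ r).deriv

theorem contDiff_imScale {g : ℂ → ℂ} (hg : Differentiable ℂ g) (a μ : ℂ) {n : ℕ∞} :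
    ContDiff ℝ n (imScale g a μ) := by
  have h1 : ContDiff ℂ n (fun z : ℂ => a * g (μ * z)) :=
    contDiff_const.mul (hg.contDiff.comp (contDiff_const.mul contDiff_id))
  exact Complex.imCLM.contDiff.comp ((h1.restrict_scalars ℝ).comp Complex.ofRealCLM.contDiff)

theorem twiceDifferentiableAt_imScale {g : ℂ → ℂ} (hg : Differentiable ℂ g) (a μ : ℂ) (r : ℝ) :
    TwiceDifferentiableAt (imScale g a μ) r :=
  ⟨Eventually.of_forall fun s => (hasDerivAt_imScale hg a μ s).differentiableAt, by
    rw [deriv_imScale hg]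
    exact (hasDerivAt_imScale hg.deriv _ μ r).differentiableAt⟩

theorem TwiceDifferentiableAt.sub {f g : ℝ → ℝ} {r : ℝ} (hf : TwiceDifferentiableAt f r)
    (hg : TwiceDifferentiableAt g r) :
    TwiceDifferentiableAt (fun s => f s - g s) r ∧
      deriv (fun s => f s - g s) r = deriv f r - deriv g r ∧
      deriv (deriv fun s => f s - g s) r = deriv (deriv f) r - deriv (deriv g) r := by
  have e : deriv (fun s => f s - g s) =ᶠ[𝓝 r] fun s => deriv f s - deriv g s := by
    filter_upwards [hf.1, hg.1] with s h1 h2 using deriv_fun_sub h1 h2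
  have hd := hf.2.hasDerivAt.fun_sub hg.2.hasDerivAt
  refine ⟨⟨?_, (hd.congr_of_eventuallyEq e).differentiableAt⟩, e.self_of_nhds,
    (hd.congr_of_eventuallyEq e).deriv⟩
  filter_upwards [hf.1, hg.1] with s h1 h2 using h1.fun_sub h2

/-! ### The coupled system as a linear system. -/

/-- `(A, C)` solves on `S` the coupled system
`r² A'' + r A' - A + p r² A + 2 κ r² C' = 0`, `C' + r C'' + q r C + 2 κ (r A' + A) = 0`. -/
structure IsPairSolution (p q κ : ℝ) (S : Set ℝ) (A C : ℝ → ℝ) : Prop where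
  twiceDiff_fst : ∀ r ∈ S, TwiceDifferentiableAt A r
  twiceDiff_snd : ∀ r ∈ S, TwiceDifferentiableAt C r
  eq_fst : ∀ r ∈ S, r ^ 2 * deriv (deriv A) r + r * deriv A r - A r + p * r ^ 2 * A r
    + 2 * κ * r ^ 2 * deriv C r = 0
  eq_snd : ∀ r ∈ S, deriv C r + r * deriv (deriv C) r + q * r * C r
    + 2 * κ * r * deriv A r + 2 * κ * A r = 0

theorem IsPairSolution.mono {p q κ : ℝ} {S T : Set ℝ} {A C : ℝ → ℝ}
    (h : IsPairSolution p q κ T A C) (hST : S ⊆ T) : IsPairSolution p q κ S A C :=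
  ⟨fun r hr => h.1 r (hST hr), fun r hr => h.2 r (hST hr), fun r hr => h.3 r (hST hr),
    fun r hr => h.4 r (hST hr)⟩

theorem IsPairSolution.sub {p q κ : ℝ} {S : Set ℝ} {A C A' C' : ℝ → ℝ}
    (h : IsPairSolution p q κ S A C) (h' : IsPairSolution p q κ S A' C') :
    IsPairSolution p q κ S (fun r => A r - A' r) (fun r => C r - C' r) where
  twiceDiff_fst r hr := ((h.1 r hr).sub (h'.1 r hr)).1
  twiceDiff_snd r hr := ((h.2 r hr).sub (h'.2 r hr)).1
  eq_fst r hr := by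
    obtain ⟨-, a1, a2⟩ := (h.1 r hr).sub (h'.1 r hr)
    obtain ⟨-, c1, c2⟩ := (h.2 r hr).sub (h'.2 r hr)
    rw [a1, a2, c1]
    linear_combination h.3 r hr - h'.3 r hr
  eq_snd r hr := by
    obtain ⟨-, a1, a2⟩ := (h.1 r hr).sub (h'.1 r hr)
    obtain ⟨-, c1, c2⟩ := (h.2 r hr).sub (h'.2 r hr)
    rw [a1, c2, c1]
    linear_combination h.4 r hr - h'.4 r hr

/-! ### Two one-variable lemmas: Grönwall, and the limit of r F'(r). -/

/-- A nonnegative function with `|f'| ≤ K f` that vanishes at one end of an interval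
vanishes on it. -/
theorem eq_zero_of_abs_deriv_le {f f' : ℝ → ℝ} {a b K : ℝ} (hf : ContinuousOn f (Icc a b))
    (hf' : ∀ x ∈ Ioo a b, HasDerivAt f (f' x) x) (hnn : ∀ x ∈ Icc a b, 0 ≤ f x)
    (hK : ∀ x ∈ Ioo a b, |f' x| ≤ K * f x) (h0 : f a = 0 ∨ f b = 0) :
    ∀ x ∈ Icc a b, f x = 0 := by
  intro x hx
  have hd : ∀ c : ℝ, ∀ y ∈ Ioo a b, HasDerivAt (fun y => Real.exp (c * y) * f y)
      (Real.exp (c * y) * (c * f y + f' y)) y := by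
    intro c y hy
    have h := (((hasDerivAt_id y).const_mul c).exp).fun_mul (hf' y hy)
    refine h.congr_deriv ?_
    simp only [id]
    ring
  have hc : ∀ c : ℝ, ContinuousOn (fun y => Real.exp (c * y) * f y) (Icc a b) := fun c =>
    (by fun_prop : Continuous fun y => Real.exp (c * y)).continuousOn.mul hf
  have hab : a ≤ b := hx.1.trans hx.2
  refine le_antisymm ?_ (hnn x hx)
  rcases h0 with h0 | h0
  -- Grönwall by integrating factor: exp(-Kx) f decreases from a zero at a; in the other case
  -- exp(Kx) f increases to a zero at b.
  · have hm : AntitoneOn (fun y => Real.exp (-K * y) * f y) (Icc a b) := by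
      refine antitoneOn_of_deriv_nonpos (convex_Icc a b) (hc _) ?_ ?_
      · rw [interior_Icc]
        exact fun y hy => (hd _ y hy).differentiableAt.differentiableWithinAt
      · rw [interior_Icc]
        intro y hy
        rw [(hd _ y hy).deriv]
        have := (abs_le.1 (hK y hy)).2
        exact mul_nonpos_of_nonneg_of_nonpos (Real.exp_pos _).le (by linarith)
    have := hm (left_mem_Icc.2 hab) hx hx.1
    simp only [h0, mul_zero] at this
    exact nonpos_of_mul_nonpos_right this (Real.exp_pos _)
  · have hm : MonotoneOn (fun y => Real.exp (K * y) * f y) (Icc a b) := by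
      refine monotoneOn_of_deriv_nonneg (convex_Icc a b) (hc _) ?_ ?_
      · rw [interior_Icc]
        exact fun y hy => (hd _ y hy).differentiableAt.differentiableWithinAt
      · rw [interior_Icc]
        intro y hy
        rw [(hd _ y hy).deriv]
        have := (abs_le.1 (hK y hy)).1
        exact mul_nonneg (Real.exp_pos _).le (by linarith)
    have := hm hx (right_mem_Icc.2 hab) hx.2
    simp only [h0, mul_zero] at this
    exact nonpos_of_mul_nonpos_right this (Real.exp_pos _)

/-- If `F` is continuous at `0` from the right, then `r F'(r)` has no nonzero limit there. -/
theorem eq_zero_of_tendsto_mul_deriv {F F' : ℝ → ℝ} {w : ℝ}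
    (hF : ContinuousWithinAt F (Ioi 0) 0) (hF' : ∀ r ∈ Ioo (0 : ℝ) 1, HasDerivAt F (F' r) r)
    (hw : Tendsto (fun r => r * F' r) (𝓝[>] 0) (𝓝 w)) : w = 0 := by
  -- Mean value theorem on [h, 2h]: |ξ F'(ξ)| = (ξ/h)|F(2h) - F(h)| ≤ 2|F(2h) - F(h)|, which tends
  -- to 0. The conditions on h sit inside the existential so that ξ can be chosen as a total
  -- function.
  have hex : ∀ h : ℝ, ∃ ξ, 0 < h → 2 * h < 1 →
      ξ ∈ Ioo h (2 * h) ∧ F' ξ = (F (2 * h) - F h) / (2 * h - h) := by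
    intro h
    by_cases hh : 0 < h ∧ 2 * h < 1
    · obtain ⟨ξ, hξ, e⟩ := exists_hasDerivAt_eq_slope F F' (by linarith : h < 2 * h)
        (fun x hx => (hF' x ⟨by linarith [hx.1], by linarith [hx.2]⟩).continuousAt
          |>.continuousWithinAt)
        (fun x hx => hF' x ⟨by linarith [hx.1], by linarith [hx.2]⟩)
      exact ⟨ξ, fun _ _ => ⟨hξ, e⟩⟩
    · exact ⟨0, fun h1 h2 => absurd ⟨h1, h2⟩ hh⟩
  choose ξ hξ using hex
  have hev : ∀ᶠ h : ℝ in 𝓝[>] 0, 0 < h ∧ 2 * h < 1 := by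
    filter_upwards [Ioo_mem_nhdsGT (by norm_num : (0 : ℝ) < 1 / 2)] with h hh
    exact ⟨hh.1, by linarith [hh.2]⟩
  have hid : Tendsto (fun h : ℝ => h) (𝓝[>] 0) (𝓝 0) := nhdsWithin_le_nhds
  have h2 : Tendsto (fun h : ℝ => 2 * h) (𝓝[>] 0) (𝓝 0) := by simpa using hid.const_mul 2
  have h2' : Tendsto (fun h : ℝ => 2 * h) (𝓝[>] 0) (𝓝[>] 0) :=
    tendsto_nhdsWithin_iff.2 ⟨h2, hev.mono fun h hh => by simpa using hh.1⟩
  have hξ0 : Tendsto ξ (𝓝[>] 0) (𝓝[>] 0) := by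
    refine tendsto_nhdsWithin_iff.2 ⟨tendsto_of_tendsto_of_tendsto_of_le_of_le' hid h2 ?_ ?_, ?_⟩
    · filter_upwards [hev] with h hh using (hξ h hh.1 hh.2).1.1.le
    · filter_upwards [hev] with h hh using (hξ h hh.1 hh.2).1.2.le
    · filter_upwards [hev] with h hh using hh.1.trans (hξ h hh.1 hh.2).1.1
  have hdiff : Tendsto (fun h => 2 * |F (2 * h) - F h|) (𝓝[>] 0) (𝓝 0) := by
    have : Tendsto (fun h => 2 * |F (2 * h) - F h|) (𝓝[>] 0) (𝓝 (2 * |F 0 - F 0|)) :=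
      ((Tendsto.sub (hF.tendsto.comp h2') hF.tendsto).abs).const_mul 2
    simpa using this
  refine tendsto_nhds_unique (hw.comp hξ0) (squeeze_zero_norm' ?_ hdiff)
  filter_upwards [hev] with h hh
  obtain ⟨⟨l1, l2⟩, e⟩ := hξ h hh.1 hh.2
  have hp := hh.1
  rw [Function.comp_apply, e, Real.norm_eq_abs, show 2 * h - h = h by ring, abs_mul, abs_div,
    abs_of_pos hp, abs_of_pos (hp.trans l1), ← mul_div_assoc, div_le_iff₀ hp]
  nlinarith [abs_nonneg (F (2 * h) - F h)]

/-! ### Lagrange's identity and vanishing near 1. -/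

/-- Lagrange's identity: two solutions of the coupled system, one of them regular at the origin and
the other one continuous there, are orthogonal for the associated alternating form. -/
theorem IsPairSolution.lagrange_eq_zero {p q κ : ℝ} {A C u v : ℝ → ℝ}
    (h : IsPairSolution p q κ (Ioo 0 1) A C) (hA : ContinuousWithinAt A (Ioi 0) 0)
    (hC : ContinuousWithinAt C (Ioi 0) 0) (huv : IsPairSolution p q κ (Ioo 0 1) u v)
    (hu : ContDiff ℝ 1 u) (hv : ContDiff ℝ 1 v) {r : ℝ} (hr : r ∈ Ioo (0 : ℝ) 1) :
    u r * deriv A r - A r * deriv u r - (v r * deriv C r - C r * deriv v r)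
      + 2 * κ * (u r * C r - A r * v r) = 0 := by
  set W : ℝ → ℝ := fun r => r * (u r * deriv A r - A r * deriv u r
    - (v r * deriv C r - C r * deriv v r) + 2 * κ * (u r * C r - A r * v r)) with hW
  -- After division of the first equation by r, the couplings r C' and (r A)' are adjoint up to
  -- sign. Pairing the second equation with the opposite sign makes the system formally
  -- self-adjoint.
  have hWd : ∀ r ∈ Ioo (0 : ℝ) 1, HasDerivAt W 0 r := by
    intro r hr
    have A1 := (h.1 r hr).1.self_of_nhds.hasDerivAt
    have A2 := (h.1 r hr).2.hasDerivAt
    have C1 := (h.2 r hr).1.self_of_nhds.hasDerivAt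
    have C2 := (h.2 r hr).2.hasDerivAt
    have u1 := (huv.1 r hr).1.self_of_nhds.hasDerivAt
    have u2 := (huv.1 r hr).2.hasDerivAt
    have v1 := (huv.2 r hr).1.self_of_nhds.hasDerivAt
    have v2 := (huv.2 r hr).2.hasDerivAt
    have hd := (hasDerivAt_id r).fun_mul
      ((((u1.fun_mul A2).fun_sub (A1.fun_mul u2)).fun_sub
        ((v1.fun_mul C2).fun_sub (C1.fun_mul v2))).fun_add
        (((u1.fun_mul C1).fun_sub (A1.fun_mul v1)).const_mul (2 * κ)))
    refine hd.congr_deriv (Eq.symm ?_)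
    refine mul_left_cancel₀ hr.1.ne' ?_
    simp only [id]
    linear_combination -(u r) * h.3 r hr + A r * huv.3 r hr + r * v r * h.4 r hr
      - r * C r * huv.4 r hr
  have hconst : ∀ s ∈ Ioo (0 : ℝ) 1, W s = W r := fun s hs =>
    isOpen_Ioo.is_const_of_deriv_eq_zero isPreconnected_Ioo
      (fun x hx => (hWd x hx).differentiableAt.differentiableWithinAt)
      (fun x hx => (hWd x hx).deriv) hs hr
  have hz : W r = 0 := by
    have cw : ∀ {f : ℝ → ℝ}, Continuous f → ContinuousWithinAt f (Ioi 0) 0 :=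
      fun hf => hf.continuousAt.continuousWithinAt
    have cu := cw hu.continuous
    have cv := cw hv.continuous
    have cu' := cw (hu.continuous_deriv le_rfl)
    have cv' := cw (hv.continuous_deriv le_rfl)
    refine eq_zero_of_tendsto_mul_deriv (F := fun r => u r * A r - v r * C r)
      (F' := fun r => (deriv u r * A r + u r * deriv A r)
        - (deriv v r * C r + v r * deriv C r))
      ((cu.mul hA).sub (cv.mul hC)) ?_ ?_
    · intro s hs
      exact ((huv.1 s hs).1.self_of_nhds.hasDerivAt.fun_mul
        (h.1 s hs).1.self_of_nhds.hasDerivAt).fun_sub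
        ((huv.2 s hs).1.self_of_nhds.hasDerivAt.fun_mul (h.2 s hs).1.self_of_nhds.hasDerivAt)
    -- r F'(r) differs from the constant W by r times a function bounded near 0, as it contains no
    -- derivative of A or C.
    · have hlim : ContinuousWithinAt (fun s => W r - s * (-2 * A s * deriv u s
          + 2 * C s * deriv v s + 2 * κ * (u s * C s - A s * v s))) (Ioi 0) 0 :=
        continuousWithinAt_const.sub (continuousWithinAt_id.mul
          ((((continuousWithinAt_const.mul hA).mul cu').add
            ((continuousWithinAt_const.mul hC).mul cv')).add
            (continuousWithinAt_const.mul ((cu.mul hC).sub (hA.mul cv)))))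
      have hlim' := hlim.tendsto
      simp only [zero_mul, sub_zero] at hlim'
      refine hlim'.congr' ?_
      filter_upwards [Ioo_mem_nhdsGT (zero_lt_one (α := ℝ))] with s hs
      rw [← hconst s hs]
      simp only [hW]
      ring
  exact (mul_eq_zero.1 hz).resolve_left hr.1.ne'

/-- A solution of the coupled system that is continuous on `[0, 1]` and vanishes at `1` vanishes
near `1`, provided two regular solutions are independent at `1`. -/
theorem IsPairSolution.exists_eq_zero_near_one {p q κ : ℝ} {A C u₁ v₁ u₂ v₂ : ℝ → ℝ}
    (h : IsPairSolution p q κ (Ioo 0 1) A C) (hA : ContinuousOn A (Icc 0 1))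
    (hC : ContinuousOn C (Icc 0 1)) (hA1 : A 1 = 0) (hC1 : C 1 = 0)
    (h₁ : IsPairSolution p q κ (Ioo 0 1) u₁ v₁) (hu₁ : ContDiff ℝ 1 u₁) (hv₁ : ContDiff ℝ 1 v₁)
    (h₂ : IsPairSolution p q κ (Ioo 0 1) u₂ v₂) (hu₂ : ContDiff ℝ 1 u₂) (hv₂ : ContDiff ℝ 1 v₂)
    (hdet : u₁ 1 * v₂ 1 - u₂ 1 * v₁ 1 ≠ 0) :
    ∃ ε ∈ Ioo (0 : ℝ) 1, ∀ r ∈ Icc ε 1, A r = 0 ∧ C r = 0 := by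
  have hc : ∀ f : ℝ → ℝ, ContinuousOn f (Icc 0 1) → ContinuousWithinAt f (Ioi 0) 0 := fun f hf =>
    (hf 0 (by simp)).mono_of_mem_nhdsWithin (Icc_mem_nhdsGT zero_lt_one)
  have L₁ := fun r hr => h.lagrange_eq_zero (hc A hA) (hc C hC) h₁ hu₁ hv₁ (r := r) hr
  have L₂ := fun r hr => h.lagrange_eq_zero (hc A hA) (hc C hC) h₂ hu₂ hv₂ (r := r) hr
  have cu₁ := hu₁.continuous
  have cv₁ := hv₁.continuous
  have cu₂ := hu₂.continuous
  have cv₂ := hv₂.continuous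
  have cu₁' := hu₁.continuous_deriv le_rfl
  have cv₁' := hv₁.continuous_deriv le_rfl
  have cu₂' := hu₂.continuous_deriv le_rfl
  have cv₂' := hv₂.continuous_deriv le_rfl
  set D : ℝ → ℝ := fun r => u₁ r * v₂ r - u₂ r * v₁ r with hD
  have cD : Continuous D := by fun_prop
  -- Cramer's rule for the two Lagrange identities: D A' = a A + b C and D C' = c A + d C.
  set a : ℝ → ℝ := fun r =>
    v₂ r * (deriv u₁ r + 2 * κ * v₁ r) - v₁ r * (deriv u₂ r + 2 * κ * v₂ r) with ha
  set b : ℝ → ℝ := fun r =>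
    v₁ r * (deriv v₂ r + 2 * κ * u₂ r) - v₂ r * (deriv v₁ r + 2 * κ * u₁ r) with hb
  set c : ℝ → ℝ := fun r =>
    u₂ r * (deriv u₁ r + 2 * κ * v₁ r) - u₁ r * (deriv u₂ r + 2 * κ * v₂ r) with hc
  set d : ℝ → ℝ := fun r =>
    u₁ r * (deriv v₂ r + 2 * κ * u₂ r) - u₂ r * (deriv v₁ r + 2 * κ * u₁ r) with hd
  have ca : Continuous a := by fun_prop
  have cb : Continuous b := by fun_prop
  have cc : Continuous c := by fun_prop
  have cd : Continuous d := by fun_prop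
  -- Grönwall rate for A² + C²; by continuity it stays below N(1) + 1 near 1.
  set N : ℝ → ℝ := fun r => 2 * (|a r| + |b r| + |c r| + |d r|) / |D r| with hN
  have cN : ContinuousAt N 1 :=
    (by fun_prop : Continuous fun r => 2 * (|a r| + |b r| + |c r| + |d r|)).continuousAt.div
      cD.abs.continuousAt (abs_ne_zero.2 hdet)
  have hev : ∀ᶠ r in 𝓝 (1 : ℝ), 0 < r ∧ D r ≠ 0 ∧ N r < N 1 + 1 :=
    (eventually_gt_nhds zero_lt_one).and ((cD.continuousAt.eventually_ne hdet).and
      (cN.tendsto.eventually_lt_const (lt_add_one _)))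
  obtain ⟨δ, hδ, hball⟩ := Metric.eventually_nhds_iff.1 hev
  set ε := max (1 / 2) (1 - δ / 2) with hε
  have hε0 : 0 < ε := lt_of_lt_of_le (by norm_num) (le_max_left _ _)
  have hε1 : ε < 1 := max_lt (by norm_num) (by linarith)
  have hεδ : 1 - δ / 2 ≤ ε := le_max_right _ _
  have hI : ∀ r ∈ Ioo ε 1, r ∈ Ioo (0 : ℝ) 1 := fun r hr => ⟨hε0.trans hr.1, hr.2⟩
  have hsub : Icc ε 1 ⊆ Icc 0 1 := Icc_subset_Icc_left hε0.le
  refine ⟨ε, ⟨hε0, hε1⟩, fun r hr => ?_⟩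
  have key := eq_zero_of_abs_deriv_le (f := fun r => A r ^ 2 + C r ^ 2)
    (f' := fun r => 2 * A r * deriv A r + 2 * C r * deriv C r) (a := ε) (b := 1) (K := N 1 + 1)
    (((hA.mono hsub).pow 2).add ((hC.mono hsub).pow 2)) ?_ (fun x _ => by positivity) ?_
    (Or.inr (by simp [hA1, hC1])) r hr
  · constructor <;> nlinarith [sq_nonneg (A r), sq_nonneg (C r)]
  · intro x hx
    have A1 := (h.1 x (hI x hx)).1.self_of_nhds.hasDerivAt
    have C1 := (h.2 x (hI x hx)).1.self_of_nhds.hasDerivAt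
    refine ((A1.fun_pow 2).fun_add (C1.fun_pow 2)).congr_deriv ?_
    norm_num
  · intro x hx
    have hx1 : dist x 1 < δ := by
      rw [Real.dist_eq, abs_sub_comm, abs_of_pos (by linarith [hx.2])]
      linarith [hx.1]
    obtain ⟨-, hDx, hNx⟩ := hball hx1
    have e1 : D x * deriv A x = a x * A x + b x * C x := by
      simp only [hD, ha, hb]
      linear_combination v₂ x * L₁ x (hI x hx) - v₁ x * L₂ x (hI x hx)
    have e2 : D x * deriv C x = c x * A x + d x * C x := by
      simp only [hD, hc, hd]
      linear_combination u₂ x * L₁ x (hI x hx) - u₁ x * L₂ x (hI x hx)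
    have hDp : 0 < |D x| := abs_pos.2 hDx
    refine le_trans ?_ (mul_le_mul_of_nonneg_right hNx.le (by positivity))
    rw [hN, div_mul_eq_mul_div, le_div_iff₀ hDp, ← abs_mul]
    have e3 : (2 * A x * deriv A x + 2 * C x * deriv C x) * D x
        = 2 * (a x * A x ^ 2 + (b x + c x) * (A x * C x) + d x * C x ^ 2) := by
      linear_combination 2 * A x * e1 + 2 * C x * e2
    have hAC : |A x * C x| ≤ A x ^ 2 + C x ^ 2 :=
      abs_le.2 ⟨by nlinarith [sq_nonneg (A x + C x)], by nlinarith [sq_nonneg (A x - C x)]⟩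
    have hAA : |A x ^ 2| ≤ A x ^ 2 + C x ^ 2 := by
      rw [abs_of_nonneg (sq_nonneg _)]
      exact le_add_of_nonneg_right (sq_nonneg _)
    have hCC : |C x ^ 2| ≤ A x ^ 2 + C x ^ 2 := by
      rw [abs_of_nonneg (sq_nonneg _)]
      exact le_add_of_nonneg_left (sq_nonneg _)
    rw [e3, abs_mul, abs_two, mul_assoc]
    refine mul_le_mul_of_nonneg_left ?_ zero_le_two
    calc |a x * A x ^ 2 + (b x + c x) * (A x * C x) + d x * C x ^ 2|
        ≤ |a x| * |A x ^ 2| + (|b x| + |c x|) * |A x * C x| + |d x| * |C x ^ 2| := by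
          refine (abs_add_three _ _ _).trans ?_
          rw [abs_mul, abs_mul, abs_mul (d x)]
          gcongr
          exact abs_add_le _ _
      _ ≤ |a x| * (A x ^ 2 + C x ^ 2) + (|b x| + |c x|) * (A x ^ 2 + C x ^ 2)
          + |d x| * (A x ^ 2 + C x ^ 2) := by gcongr
      _ = _ := by ring

/-! ### Propagation of zero data away from the origin. -/

theorem abs_energy_deriv_le {x y z w y' w' M : ℝ}
    (hy : |y'| ≤ M * (|x| + |y| + |z| + |w|)) (hw : |w'| ≤ M * (|x| + |y| + |z| + |w|)) :
    |2 * x * y + 2 * y * y' + 2 * z * w + 2 * w * w'|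
      ≤ (4 + 4 * M) * (2 * (x ^ 2 + y ^ 2 + z ^ 2 + w ^ 2)) := by
  set s := |x| + |y| + |z| + |w| with hs
  have hx0 := abs_nonneg x
  have hy0 := abs_nonneg y
  have hz0 := abs_nonneg z
  have hw0 := abs_nonneg w
  have hM : 0 ≤ M * s := (abs_nonneg _).trans hy
  have hs2 : s ^ 2 ≤ 4 * (x ^ 2 + y ^ 2 + z ^ 2 + w ^ 2) := by
    rw [← sq_abs x, ← sq_abs y, ← sq_abs z, ← sq_abs w]
    nlinarith [sq_nonneg (|x| - |y|), sq_nonneg (|x| - |z|), sq_nonneg (|x| - |w|),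
      sq_nonneg (|y| - |z|), sq_nonneg (|y| - |w|), sq_nonneg (|z| - |w|)]
  have h1 : |2 * x * y + 2 * y * y' + 2 * z * w + 2 * w * w'|
      ≤ 2 * |x| * |y| + 2 * |y| * |y'| + 2 * |z| * |w| + 2 * |w| * |w'| := by
    refine (abs_add_le _ _).trans (add_le_add ((abs_add_three _ _ _).trans_eq ?_) ?_) <;>
    simp only [abs_mul, abs_two, le_refl]
  have h2 : |y| * |y'| ≤ |y| * (M * s) := mul_le_mul_of_nonneg_left hy hy0
  have h3 : |w| * |w'| ≤ |w| * (M * s) := mul_le_mul_of_nonneg_left hw hw0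
  have h4 : 2 * |x| * |y| + 2 * |z| * |w| ≤ s ^ 2 := by
    rw [hs]
    nlinarith [mul_nonneg hx0 hz0, mul_nonneg hx0 hw0, mul_nonneg hy0 hz0, mul_nonneg hy0 hw0]
  have h5 : (|y| + |w|) * (M * s) ≤ s * (M * s) :=
    mul_le_mul_of_nonneg_right (by rw [hs]; linarith) hM
  -- The hypotheses force M ≥ 0 only if s > 0; if s = 0, all four variables vanish.
  rcases eq_or_lt_of_le (show 0 ≤ s by positivity) with h0 | h0
  · have e : x = 0 ∧ y = 0 ∧ z = 0 ∧ w = 0 := by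
      refine ⟨abs_eq_zero.1 ?_, abs_eq_zero.1 ?_, abs_eq_zero.1 ?_, abs_eq_zero.1 ?_⟩ <;> linarith
    obtain ⟨rfl, rfl, rfl, rfl⟩ := e
    simp
  · have hM0 : 0 ≤ M := nonneg_of_mul_nonneg_left hM h0
    nlinarith [mul_le_mul_of_nonneg_left hs2 hM0]

theorem IsPairSolution.energy_eq_zero {p q κ a b : ℝ} {A C : ℝ → ℝ} (ha : 0 < a)
    (h : IsPairSolution p q κ (Icc a b) A C)
    (h0 : A a ^ 2 + deriv A a ^ 2 + C a ^ 2 + deriv C a ^ 2 = 0 ∨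
      A b ^ 2 + deriv A b ^ 2 + C b ^ 2 + deriv C b ^ 2 = 0) :
    ∀ x ∈ Icc a b, A x ^ 2 + deriv A x ^ 2 + C x ^ 2 + deriv C x ^ 2 = 0 := by
  -- Bounds every coefficient of the equations solved for A'' and C'' on [a, b], where 1/x ≤ 1/a.
  set M : ℝ := a⁻¹ + a⁻¹ ^ 2 + |p| + |q| + 2 * |κ| + 2 * |κ| * a⁻¹ with hM
  have hE : ∀ x ∈ Icc a b, HasDerivAt
      (fun x => A x ^ 2 + deriv A x ^ 2 + C x ^ 2 + deriv C x ^ 2)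
      (2 * A x * deriv A x + 2 * deriv A x * deriv (deriv A) x + 2 * C x * deriv C x
        + 2 * deriv C x * deriv (deriv C) x) x := by
    intro x hx
    have A1 := (h.1 x hx).1.self_of_nhds.hasDerivAt
    have A2 := (h.1 x hx).2.hasDerivAt
    have C1 := (h.2 x hx).1.self_of_nhds.hasDerivAt
    have C2 := (h.2 x hx).2.hasDerivAt
    refine ((((A1.fun_pow 2).fun_add (A2.fun_pow 2)).fun_add (C1.fun_pow 2)).fun_add
      (C2.fun_pow 2)).congr_deriv ?_
    norm_num
  refine eq_zero_of_abs_deriv_le (K := (4 + 4 * M) * 2)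
    (fun x hx => (hE x hx).continuousAt.continuousWithinAt)
    (fun x hx => hE x (Ioo_subset_Icc_self hx)) (fun x _ => by positivity) (fun x hx' => ?_) h0
  have hx := Ioo_subset_Icc_self hx'
  have hx0 : 0 < x := ha.trans_le hx.1
  have hi : x⁻¹ ≤ a⁻¹ := inv_anti₀ ha hx.1
  have hip : 0 < x⁻¹ := inv_pos.2 hx0
  have hap : 0 < a⁻¹ := inv_pos.2 ha
  have e1 : deriv (deriv A) x
      = -x⁻¹ * deriv A x + x⁻¹ ^ 2 * A x + -p * A x + -(2 * κ) * deriv C x := by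
    field_simp
    linear_combination h.3 x hx
  have e2 : deriv (deriv C) x
      = -x⁻¹ * deriv C x + -q * C x + -(2 * κ) * deriv A x + -(2 * κ) * x⁻¹ * A x := by
    field_simp
    linear_combination h.4 x hx
  have tri : ∀ s t u v : ℝ, |s + t + u + v| ≤ |s| + |t| + |u| + |v| := fun s t u v =>
    (abs_add_le _ _).trans (by linarith [abs_add_three s t u])
  rw [mul_assoc (4 + 4 * M)]
  have hA0 := abs_nonneg (A x)
  have hA1 := abs_nonneg (deriv A x)
  have hC0 := abs_nonneg (C x)
  have hC1 := abs_nonneg (deriv C x)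
  have hp := abs_nonneg p
  have hq := abs_nonneg q
  have hκ := abs_nonneg κ
  have hκa := mul_nonneg hκ hap.le
  have hmono : ∀ {t y : ℝ}, t ≤ M → 0 ≤ y → t * y ≤ M * y := fun h1 h2 =>
    mul_le_mul_of_nonneg_right h1 h2
  have ha2 := sq_nonneg a⁻¹
  refine abs_energy_deriv_le ?_ ?_
  · rw [e1]
    refine (tri _ _ _ _).trans ?_
    simp only [abs_mul, abs_neg, abs_pow, abs_two, abs_of_pos hip]
    have b1 : x⁻¹ ^ 2 ≤ a⁻¹ ^ 2 := by gcongr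
    have t1 : (x⁻¹ ^ 2 + |p|) * |A x| ≤ M * |A x| := hmono (by linarith) hA0
    have t2 : x⁻¹ * |deriv A x| ≤ M * |deriv A x| := hmono (by linarith) hA1
    have t3 : 0 * |C x| ≤ M * |C x| := hmono (by linarith) hC0
    have t4 : 2 * |κ| * |deriv C x| ≤ M * |deriv C x| := hmono (by linarith) hC1
    linarith
  · rw [e2]
    refine (tri _ _ _ _).trans ?_
    simp only [abs_mul, abs_neg, abs_two, abs_of_pos hip]
    have b1 : |κ| * x⁻¹ ≤ |κ| * a⁻¹ := by gcongr
    have t1 : 2 * |κ| * x⁻¹ * |A x| ≤ M * |A x| := hmono (by linarith) hA0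
    have t2 : 2 * |κ| * |deriv A x| ≤ M * |deriv A x| := hmono (by linarith) hA1
    have t3 : |q| * |C x| ≤ M * |C x| := hmono (by linarith) hC0
    have t4 : x⁻¹ * |deriv C x| ≤ M * |deriv C x| := hmono (by linarith) hC1
    linarith

theorem interior_subset_Ioi {I : Set ℝ} (hI : I ⊆ Ici 0) : interior I ⊆ Ioi 0 := by
  rw [← interior_Ici]
  exact interior_mono hI

theorem Ioo_subset_interior {I : Set ℝ} (hI : Icc 0 1 ⊆ I) : Ioo (0 : ℝ) 1 ⊆ interior I :=
  interior_maximal (Ioo_subset_Icc_self.trans hI) isOpen_Ioo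

/-- Uniqueness for the coupled system with homogeneous boundary values at `1`, among pairs
that are continuous at `0`. -/
theorem IsPairSolution.eqOn_zero {p q κ : ℝ} {I : Set ℝ} {A C u₁ v₁ u₂ v₂ : ℝ → ℝ}
    (hI : I.OrdConnected) (hI1 : Icc 0 1 ⊆ I) (hI0 : I ⊆ Ici 0)
    (h : IsPairSolution p q κ (interior I) A C) (hA : ContinuousOn A I)
    (hC : ContinuousOn C I) (hA1 : A 1 = 0) (hC1 : C 1 = 0)
    (h₁ : IsPairSolution p q κ (Ioo 0 1) u₁ v₁) (hu₁ : ContDiff ℝ 1 u₁) (hv₁ : ContDiff ℝ 1 v₁)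
    (h₂ : IsPairSolution p q κ (Ioo 0 1) u₂ v₂) (hu₂ : ContDiff ℝ 1 u₂) (hv₂ : ContDiff ℝ 1 v₂)
    (hdet : u₁ 1 * v₂ 1 - u₂ 1 * v₁ 1 ≠ 0) :
    EqOn A (fun _ => 0) I ∧ EqOn C (fun _ => 0) I := by
  obtain ⟨ε, hε, hz⟩ := (h.mono (Ioo_subset_interior hI1)).exists_eq_zero_near_one (hA.mono hI1)
    (hC.mono hI1) hA1 hC1 h₁ hu₁ hv₁ h₂ hu₂ hv₂ hdet
  -- A point inside the zero region, where the derivatives vanish as well: full zero Cauchy data.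
  obtain ⟨s, hs⟩ := exists_between hε.2
  have hsI : s ∈ interior I := Ioo_subset_interior hI1 ⟨hε.1.trans hs.1, hs.2⟩
  have hevA : A =ᶠ[𝓝 s] fun _ => 0 := by
    filter_upwards [Icc_mem_nhds hs.1 hs.2] with x hx using (hz x hx).1
  have hevC : C =ᶠ[𝓝 s] fun _ => 0 := by
    filter_upwards [Icc_mem_nhds hs.1 hs.2] with x hx using (hz x hx).2
  have hE : A s ^ 2 + deriv A s ^ 2 + C s ^ 2 + deriv C s ^ 2 = 0 := by
    rw [hevA.deriv_eq, hevC.deriv_eq, hevA.self_of_nhds, hevC.self_of_nhds]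
    simp
  have hord : (interior I).OrdConnected := hI.interior
  have hall : ∀ r ∈ interior I, A r ^ 2 + deriv A r ^ 2 + C r ^ 2 + deriv C r ^ 2 = 0 := by
    intro r hr
    rcases le_total s r with hsr | hsr
    · exact (h.mono (hord.out hsI hr)).energy_eq_zero (interior_subset_Ioi hI0 hsI) (Or.inl hE) r
        ⟨hsr, le_rfl⟩
    · exact (h.mono (hord.out hr hsI)).energy_eq_zero (interior_subset_Ioi hI0 hr) (Or.inr hE) r
        ⟨le_rfl, hsr⟩
  have hcl : I ⊆ closure (interior I) := by
    rw [(hI.convex : Convex ℝ I).closure_interior_eq_closure_of_nonempty_interior ⟨s, hsI⟩]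
    exact subset_closure
  constructor
  · refine EqOn.of_subset_closure (fun r hr => ?_) hA continuousOn_const interior_subset hcl
    have := hall r hr
    show A r = 0
    nlinarith [sq_nonneg (A r), sq_nonneg (deriv A r), sq_nonneg (C r), sq_nonneg (deriv C r)]
  · refine EqOn.of_subset_closure (fun r hr => ?_) hC continuousOn_const interior_subset hcl
    have := hall r hr
    show C r = 0
    nlinarith [sq_nonneg (A r), sq_nonneg (deriv A r), sq_nonneg (C r), sq_nonneg (deriv C r)]

/-! ### Algebra of ζ and the Bessel solutions. -/

theorem sq_relation {ζ : ℂ} (hζ : ζ ^ 2 = (-1 + Complex.I * (√7 : ℝ)) / 2) :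
    ζ ^ 4 + ζ ^ 2 + 2 = 0 := by
  have h7 : ((√7 : ℝ) : ℂ) ^ 2 = 7 := by
    rw [← Complex.ofReal_pow, Real.sq_sqrt (by norm_num)]
    norm_num
  have : ζ ^ 4 = (ζ ^ 2) ^ 2 := by ring
  rw [this, hζ]
  linear_combination (Complex.I ^ 2 / 4) * h7 + 7 / 4 * Complex.I_sq

theorem mul_conj_eq_sqrt_two {ζ : ℂ} (hζ : ζ ^ 2 = (-1 + Complex.I * (√7 : ℝ)) / 2) :
    ζ * starRingEnd ℂ ζ = (√2 : ℝ) := by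
  have h7 : √7 * √7 = 7 := Real.mul_self_sqrt (by norm_num)
  have h : Complex.normSq (ζ ^ 2) = 2 := by
    rw [hζ, Complex.normSq_apply]
    norm_num
    linear_combination h7 / 4
  rw [map_pow] at h
  rw [Complex.mul_conj, ← h, Real.sqrt_sq (Complex.normSq_nonneg ζ)]

/-- The coefficients `√2` and `ᾱ` fit together: `ᾱ = √2 (1 - ζ²) / (2 ζ)`. -/
theorem two_mul_conj_alpha {ζ : ℂ} (hζ : ζ ^ 2 = (-1 + Complex.I * (√7 : ℝ)) / 2) :
    2 * ζ * starRingEnd ℂ (alpha ζ) = (√2 : ℝ) * (1 - ζ ^ 2) := by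
  have hm := mul_conj_eq_sqrt_two hζ
  have hconj : starRingEnd ℂ ζ ^ 2 = -1 - ζ ^ 2 := by
    rw [← map_pow, hζ]
    simp only [map_div₀, map_add, map_neg, map_one, map_mul, Complex.conj_I, Complex.conj_ofReal,
      Complex.conj_ofNat]
    ring
  have : starRingEnd ℂ (alpha ζ) = starRingEnd ℂ ζ * (starRingEnd ℂ ζ ^ 2 / 2 + 1) := by
    simp only [alpha, map_add, map_div₀, map_pow, Complex.conj_ofNat]
    ring
  rw [this, hconj]
  linear_combination (1 - ζ ^ 2) * hm

theorem deriv_deriv_besselJ_zero (z : ℂ) :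
    deriv (deriv (besselJ 0)) z = -deriv (besselJ 1) z := by
  rw [funext deriv_besselJ_zero]
  exact deriv.fun_neg

theorem bessel_equation_one (z : ℂ) :
    z ^ 2 * deriv (deriv (besselJ 1)) z + z * deriv (besselJ 1) z - besselJ 1 z
      + z ^ 2 * besselJ 1 z = 0 := by
  linear_combination z * mul_deriv_deriv_besselJ_one z - mul_deriv_besselJ_one z

theorem im_eq_zero {w : ℂ} {x : ℝ} (h : w.im = x) (hw : w = 0) : x = 0 := by
  rw [← h, hw, Complex.zero_im]

/-- The free factor c serves both halves: c = J₁(λζ̄)/d(λ) is the claimed solution, while c = 1 and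
c = i are the two real test solutions for uniqueness. -/
theorem isPairSolution_bessel {ζ : ℂ} (hζ : ζ ^ 2 = (-1 + Complex.I * (√7 : ℝ)) / 2) (lam : ℝ)
    (c : ℂ) (S : Set ℝ) : IsPairSolution (lam ^ 2) (2 * lam ^ 2) lam S
      (imScale (besselJ 1) (c * (√2 : ℝ)) (lam * ζ))
      (imScale (besselJ 0) (c * starRingEnd ℂ (alpha ζ)) (lam * ζ)) := by
  have d0 := (differentiable_besselJ 0).1
  have d1 := (differentiable_besselJ 1).1
  have hα := two_mul_conj_alpha hζ
  have h4 := sq_relation hζ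
  have hζ0 : ζ ≠ 0 := by
    rintro rfl
    norm_num at h4
  -- The second equation's condition; given the first, it amounts to (2 - ζ²)(1 - ζ²) + 4ζ² = ζ⁴ +
  -- ζ² + 2 = 0.
  have hα' : (2 - ζ ^ 2) * starRingEnd ℂ (alpha ζ) + 2 * ζ * (√2 : ℝ) = 0 := by
    refine mul_left_cancel₀ (mul_ne_zero two_ne_zero hζ0) ?_
    linear_combination (2 - ζ ^ 2) * hα + (√2 : ℝ) * h4
  refine ⟨fun r _ => twiceDifferentiableAt_imScale d1 _ _ r,
    fun r _ => twiceDifferentiableAt_imScale d0 _ _ r, fun r _ => ?_, fun r _ => ?_⟩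
  · rw [deriv_imScale d1, deriv_imScale d1.deriv, deriv_imScale d0]
    set z : ℂ := lam * ζ * r with hz
    have e := bessel_equation_one z
    have hw : c * (√2 : ℝ) * (z ^ 2 * deriv (deriv (besselJ 1)) z + z * deriv (besselJ 1) z
        - besselJ 1 z + lam ^ 2 * r ^ 2 * besselJ 1 z) - 2 * lam * r ^ 2 *
        (c * starRingEnd ℂ (alpha ζ) * (lam * ζ)) * besselJ 1 z = 0 := by
      rw [hz] at e ⊢
      linear_combination c * (√2 : ℝ) * e - c * lam ^ 2 * r ^ 2 * besselJ 1 (lam * ζ * r) * hα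
    refine im_eq_zero ?_ hw
    simp only [imScale, ← hz, deriv_besselJ_zero]
    rw [← Complex.im_ofReal_mul, ← Complex.im_ofReal_mul, ← Complex.im_ofReal_mul,
      ← Complex.im_ofReal_mul, ← Complex.add_im, ← Complex.sub_im, ← Complex.add_im,
      ← Complex.add_im]
    congr 1
    push_cast
    rw [hz]
    ring
  · rw [deriv_imScale d1, deriv_imScale d0, deriv_imScale d0.deriv]
    set z : ℂ := lam * ζ * r with hz
    have e := mul_deriv_besselJ_one z
    have hw : c * starRingEnd ℂ (alpha ζ) * (-(lam * ζ) * besselJ 1 z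
        - lam * ζ * z * deriv (besselJ 1) z + 2 * lam ^ 2 * r * besselJ 0 z)
        + 2 * lam * (c * (√2 : ℝ)) * (z * deriv (besselJ 1) z + besselJ 1 z) = 0 := by
      rw [hz] at e ⊢
      linear_combination (-(c * starRingEnd ℂ (alpha ζ) * lam * ζ) + 2 * lam * c * (√2 : ℝ)) * e
        + c * lam ^ 2 * r * besselJ 0 (lam * ζ * r) * hα'
    refine im_eq_zero ?_ hw
    simp only [imScale, ← hz, deriv_besselJ_zero, deriv_deriv_besselJ_zero]
    rw [← Complex.im_ofReal_mul, ← Complex.im_ofReal_mul, ← Complex.im_ofReal_mul,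
      ← Complex.im_ofReal_mul, ← Complex.add_im, ← Complex.add_im, ← Complex.add_im,
      ← Complex.add_im]
    congr 1
    push_cast
    rw [hz]
    ring

/-- Test solution for the B equation; the factor i turns the real value J₁(λr) into an imaginary
part. -/
theorem isPairSolution_besselJ_one (lam : ℝ) (S : Set ℝ) :
    IsPairSolution (lam ^ 2) 0 0 S (imScale (besselJ 1) Complex.I lam) (fun _ => 0) := by
  have d1 := (differentiable_besselJ 1).1
  refine ⟨fun r _ => twiceDifferentiableAt_imScale d1 _ _ r,
    fun r _ => ⟨Eventually.of_forall fun s => by fun_prop, by simp⟩,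
    fun r _ => ?_, fun r _ => by simp⟩
  rw [deriv_imScale d1, deriv_imScale d1.deriv]
  set z : ℂ := lam * r with hz
  refine im_eq_zero ?_ (mul_eq_zero_of_right Complex.I (bessel_equation_one z))
  simp only [imScale, ← hz, mul_zero, zero_mul, add_zero]
  rw [← Complex.im_ofReal_mul, ← Complex.im_ofReal_mul, ← Complex.im_ofReal_mul,
    ← Complex.add_im, ← Complex.sub_im, ← Complex.add_im]
  congr 1
  push_cast
  rw [hz]
  ring

theorem isPairSolution_const (p : ℝ) (S : Set ℝ) :
    IsPairSolution p 0 0 S (fun _ => 0) (fun _ => 1) :=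
  ⟨fun r _ => ⟨Eventually.of_forall fun s => by fun_prop, by simp⟩,
    fun r _ => ⟨Eventually.of_forall fun s => by fun_prop, by simp⟩,
    fun r _ => by simp, fun r _ => by simp⟩

/-! ### Boundary values and independence of the choice of ζ. -/

theorem solA_eq (ζ : ℂ) (lam : ℝ) : solA ζ lam = imScale (besselJ 1)
    (besselJ 1 (lam * starRingEnd ℂ ζ) / d ζ lam * (√2 : ℝ)) (lam * ζ) := by
  funext r
  rw [solA, imScale, ← Complex.im_ofReal_mul]
  congr 1
  push_cast
  ring

theorem solC_eq (ζ : ℂ) (lam : ℝ) : solC ζ lam = imScale (besselJ 0)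
    (besselJ 1 (lam * starRingEnd ℂ ζ) / d ζ lam * starRingEnd ℂ (alpha ζ)) (lam * ζ) := by
  funext r
  rw [solC, imScale, ← Complex.im_ofReal_mul]
  congr 1
  push_cast
  ring

theorem conj_besselJ_one_mul (ζ : ℂ) (lam : ℝ) :
    starRingEnd ℂ (besselJ 1 (lam * ζ)) = besselJ 1 (lam * starRingEnd ℂ ζ) := by
  rw [conj_besselJ, map_mul, Complex.conj_ofReal]

/-- At r = 1 the product is |J₁(λζ)|², which is real. -/
theorem solA_one (ζ : ℂ) (lam : ℝ) : solA ζ lam 1 = 0 := by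
  rw [solA, Complex.ofReal_one, mul_one, ← conj_besselJ_one_mul, mul_comm (starRingEnd ℂ _),
    Complex.mul_conj, Complex.ofReal_im, mul_zero]

theorem solA_zero (ζ : ℂ) (lam : ℝ) : solA ζ lam 0 = 0 := by
  simp [solA, besselJ_one_zero]

theorem solC_one {ζ : ℂ} {lam : ℝ} (hd : d ζ lam ≠ 0) : solC ζ lam 1 = 1 := by
  rw [solC, Complex.ofReal_one, mul_one, mul_right_comm, one_div]
  exact inv_mul_cancel₀ hd

theorem hasDerivAt_solC_zero (ζ : ℂ) (lam : ℝ) : HasDerivAt (solC ζ lam) 0 0 := by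
  rw [solC_eq]
  refine (hasDerivAt_imScale (differentiable_besselJ 0).1 _ _ 0).congr_deriv ?_
  simp [imScale, deriv_besselJ_zero, besselJ_one_zero]

theorem alpha_neg (ζ : ℂ) : alpha (-ζ) = -alpha ζ := by
  unfold alpha
  ring

/-- J₁ and α are odd and J₀ is even, so the two signs cancel. -/
theorem d_neg (ζ : ℂ) (lam : ℝ) : d (-ζ) lam = d ζ lam := by
  simp only [d, alpha_neg, map_neg, mul_neg, besselJ_neg]
  norm_num

theorem solA_neg (ζ : ℂ) (lam : ℝ) : solA (-ζ) lam = solA ζ lam := by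
  funext r
  simp only [solA, d_neg, map_neg, mul_neg, neg_mul, besselJ_neg]
  norm_num

theorem solC_neg (ζ : ℂ) (lam : ℝ) : solC (-ζ) lam = solC ζ lam := by
  funext r
  simp only [solC, d_neg, alpha_neg, map_neg, mul_neg, neg_mul, besselJ_neg]
  norm_num

theorem isSolution_sol {ζ : ℂ} (hζ : ζ ^ 2 = (-1 + Complex.I * (√7 : ℝ)) / 2) {lam : ℝ}
    (hd : d ζ lam ≠ 0) (I : Set ℝ) :
    IsSolution lam I (solA ζ lam) (fun _ => 0) (solC ζ lam) := by
  have hp := isPairSolution_bessel hζ lam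
    (besselJ 1 (lam * starRingEnd ℂ ζ) / d ζ lam) (interior I)
  rw [← solA_eq, ← solC_eq] at hp
  exact {
    continuousOn_A := by
      rw [solA_eq]
      exact (contDiff_imScale (differentiable_besselJ 1).1 _ _ (n := 0)).continuous.continuousOn
    continuousOn_B := continuousOn_const
    continuousOn_C := by
      rw [solC_eq]
      exact (contDiff_imScale (differentiable_besselJ 0).1 _ _ (n := 0)).continuous.continuousOn
    twiceDiff_A := hp.twiceDiff_fst
    twiceDiff_B := fun r hr => (isPairSolution_const 0 univ).twiceDiff_fst r (mem_univ r)
    twiceDiff_C := hp.twiceDiff_snd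
    eq_A := hp.eq_fst
    eq_B := fun r _ => by simp
    eq_C := fun r hr => by linear_combination hp.eq_snd r hr
    A_zero := solA_zero ζ lam
    B_zero := rfl
    deriv_C_zero := (hasDerivAt_solC_zero ζ lam).hasDerivWithinAt
    A_one := solA_one ζ lam
    B_one := rfl
    C_one := solC_one hd }

/-! ### Uniqueness for the boundary value problem. -/

theorem IsSolution.isPairSolution {lam : ℝ} {I : Set ℝ} {A B C : ℝ → ℝ}
    (h : IsSolution lam I A B C) :
    IsPairSolution (lam ^ 2) (2 * lam ^ 2) lam (interior I) A C :=
  ⟨h.twiceDiff_A, h.twiceDiff_C, h.eq_A, h.eq_C⟩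

theorem besselJ_one_ofReal_im (x : ℝ) : (besselJ 1 (x : ℂ)).im = 0 :=
  Complex.conj_eq_iff_im.1 (by rw [conj_besselJ, Complex.conj_ofReal])

theorem IsSolution.eqOn_B {lam : ℝ} {I : Set ℝ} {A B C : ℝ → ℝ} (h : IsSolution lam I A B C)
    (hI : I.OrdConnected) (hI1 : Icc 0 1 ⊆ I) (hI0 : I ⊆ Ici 0)
    (hJ : besselJ 1 (lam : ℂ) ≠ 0) : EqOn B (fun _ => 0) I := by
  have hp : IsPairSolution (lam ^ 2) 0 0 (interior I) B (fun _ => 0) :=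
    ⟨h.twiceDiff_B, fun r _ => ⟨Eventually.of_forall fun s => by fun_prop, by simp⟩,
      fun r hr => by linear_combination h.eq_B r hr, fun r _ => by simp⟩
  refine (hp.eqOn_zero hI hI1 hI0 h.continuousOn_B continuousOn_const h.B_one rfl
    (isPairSolution_besselJ_one lam _)
    (contDiff_imScale (differentiable_besselJ 1).1 _ _ (n := 1)) contDiff_const
    (isPairSolution_const _ _) contDiff_const contDiff_const ?_).1
  rw [mul_one, zero_mul, sub_zero, imScale, Complex.ofReal_one, mul_one, Complex.I_mul_im]
  exact fun h0 => hJ (Complex.ext h0 (besselJ_one_ofReal_im lam))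

theorem IsSolution.eqOn_sol {ζ : ℂ} (hζ : ζ ^ 2 = (-1 + Complex.I * (√7 : ℝ)) / 2) {lam : ℝ}
    (hd : d ζ lam ≠ 0) {I : Set ℝ} {A B C : ℝ → ℝ} (h : IsSolution lam I A B C)
    (hI : I.OrdConnected) (hI1 : Icc 0 1 ⊆ I) (hI0 : I ⊆ Ici 0) :
    EqOn A (solA ζ lam) I ∧ EqOn C (solC ζ lam) I := by
  have h' := isSolution_sol hζ hd I
  have d0 := (differentiable_besselJ 0).1
  have d1 := (differentiable_besselJ 1).1
  have hdet : -(√2 * d ζ lam) ≠ 0 :=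
    neg_ne_zero.2 (mul_ne_zero (Real.sqrt_pos.2 two_pos).ne' hd)
  obtain ⟨hA, hC⟩ := (h.isPairSolution.sub h'.isPairSolution).eqOn_zero hI hI1 hI0
    (h.continuousOn_A.sub h'.continuousOn_A) (h.continuousOn_C.sub h'.continuousOn_C)
    (by rw [h.A_one, h'.A_one, sub_zero]) (by rw [h.C_one, h'.C_one, sub_self])
    (isPairSolution_bessel hζ lam 1 _) (contDiff_imScale d1 _ _ (n := 1))
    (contDiff_imScale d0 _ _ (n := 1))
    (isPairSolution_bessel hζ lam Complex.I _) (contDiff_imScale d1 _ _ (n := 1))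
    (contDiff_imScale d0 _ _ (n := 1)) (by
      -- With P = ᾱJ₀(λζ) and Q = J₁(λζ), the determinant is √2(Im Q Re P - Re Q Im P) = -√2 Im(P
      -- Q̄).
      convert hdet using 1
      rw [d, ← conj_besselJ_one_mul]
      simp only [imScale, Complex.ofReal_one, mul_one, one_mul, mul_assoc, Complex.I_im, Complex.I_re,
        Complex.mul_im, Complex.mul_re, Complex.ofReal_re, Complex.ofReal_im, Complex.conj_re,
        Complex.conj_im]
      ring)
  exact ⟨fun r hr => sub_eq_zero.1 (hA hr), fun r hr => sub_eq_zero.1 (hC hr)⟩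

end RadialSystem

theorem mainTheorem2 (ζ : ℂ) (hζ : ζ ^ 2 = (-1 + Complex.I * (√7 : ℝ)) / 2)
    (lam : ℝ) (hlam : 0 < lam)
    (hd : (RadialSystem.d ζ lam : ℂ) * RadialSystem.besselJ 1 (lam : ℂ) ≠ 0) :
    (ContDiff ℝ (⊤ : ℕ∞) (RadialSystem.solA ζ lam) ∧
      ContDiff ℝ (⊤ : ℕ∞) (RadialSystem.solC ζ lam)) ∧
    (RadialSystem.solA (-ζ) lam = RadialSystem.solA ζ lam ∧
      RadialSystem.solC (-ζ) lam = RadialSystem.solC ζ lam) ∧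
    ∀ I : Set ℝ, I.OrdConnected → Set.Icc 0 1 ⊆ I → I ⊆ Set.Ici 0 →
      RadialSystem.IsSolution lam I
        (RadialSystem.solA ζ lam) (fun _ => 0) (RadialSystem.solC ζ lam) ∧
      ∀ A B C : ℝ → ℝ, RadialSystem.IsSolution lam I A B C →
        Set.EqOn A (RadialSystem.solA ζ lam) I ∧
        Set.EqOn B (fun _ => 0) I ∧
        Set.EqOn C (RadialSystem.solC ζ lam) I := by
  have hd' : RadialSystem.d ζ lam ≠ 0 := by
    exact_mod_cast left_ne_zero_of_mul hd
  have hJ := right_ne_zero_of_mul hd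
  refine ⟨⟨?_, ?_⟩, ⟨RadialSystem.solA_neg ζ lam, RadialSystem.solC_neg ζ lam⟩,
    fun I hI hI1 hI0 => ⟨RadialSystem.isSolution_sol hζ hd' I, fun A B C h => ?_⟩⟩
  · rw [RadialSystem.solA_eq]
    exact RadialSystem.contDiff_imScale (RadialSystem.differentiable_besselJ 1).1 _ _
  · rw [RadialSystem.solC_eq]
    exact RadialSystem.contDiff_imScale (RadialSystem.differentiable_besselJ 0).1 _ _
  · obtain ⟨hA, hC⟩ := h.eqOn_sol hζ hd' hI hI1 hI0
    exact ⟨hA, h.eqOn_B hI hI1 hI0 hJ, hC⟩
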